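/- Let $A$ be a unital Kirchberg algebra, that is, a unital, separable, nuclear, simple, purely infinite C*-algebra. Let $p\in A$ be a projection with $p\neq 0$ and $p\neq 1$ whose class $[p]_0$ in $K_0(A)$ vanishes, and put $u=1-2p$. Then for every $\varepsilon>0$ there exist positive contractions $f^{(0)},f^{(1)}\in A$ such that $$ f^{(i)}\cdot\bigl(u f^{(i)}u^*\bigr)=0\quad (i=0,1)\qquad\text{and}\qquad \Bigl\|\sum_{i=0}^{1}\bigl(f^{(i)}+u f^{(i)}u^*\bigr)-1\Bigr\|\le\varepsilon . $$ -/

import Mathlib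

open scoped ComplexOrder CStarAlgebra Matrix

noncomputable section

/-! ### Kirchberg algebras -/

section Kirchberg

variable (A : Type*) [NonUnitalCStarAlgebra A] [PartialOrder A] [StarOrderedRing A]

/-- Nuclearity, as the completely positive approximation property: the identity of `A` is a
point-norm limit of maps `ψ ∘ φ` with `φ : A → M_n(ℂ)` and `ψ : M_n(ℂ) → A` completely positive
contractions. -/
def IsNuclearCStar : Prop :=
  ∀ (F : Finset A) (ε : ℝ), 0 < ε →
    ∃ (n : ℕ) (φ : A →CP CStarMatrix (Fin n) (Fin n) ℂ) (ψ : CStarMatrix (Fin n) (Fin n) ℂ →CP A),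
      (∀ a, ‖φ a‖ ≤ ‖a‖) ∧ (∀ b, ‖ψ b‖ ≤ ‖b‖) ∧ ∀ a ∈ F, ‖ψ (φ a) - a‖ < ε

/-- A C*-algebra is simple if it is nonzero and its only closed two-sided ideals are `0` and
itself. -/
def IsSimpleCStar : Prop :=
  Nontrivial A ∧ ∀ I : TwoSidedIdeal A, IsClosed (I : Set A) → I = ⊥ ∨ I = ⊤

variable {A}

/-- A hereditary C*-subalgebra: a norm-closed star subalgebra `B` such that `0 ≤ a ≤ b` with
`b ∈ B` implies `a ∈ B`. -/
structure IsHereditaryCStarSubalgebra (B : NonUnitalStarSubalgebra ℂ A) : Prop where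
  isClosed : IsClosed (B : Set A)
  mem_of_le : ∀ a b : A, 0 ≤ a → a ≤ b → b ∈ B → a ∈ B

/-- An infinite projection: one that is Murray-von Neumann equivalent to a proper
subprojection of itself. -/
def IsInfiniteProjection (p : A) : Prop :=
  IsStarProjection p ∧ ∃ v : A, star v * v = p ∧ v * star v ≤ p ∧ v * star v ≠ p

variable (A)

/-- A (simple) C*-algebra is purely infinite if every nonzero hereditary C*-subalgebra contains
an infinite projection. -/
def IsPurelyInfiniteCStar : Prop :=
  ∀ B : NonUnitalStarSubalgebra ℂ A, IsHereditaryCStarSubalgebra B → B ≠ ⊥ →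
    ∃ p ∈ B, IsInfiniteProjection p

/-- Kirchberg algebras: separable, nuclear, simple, purely infinite C*-algebras. -/
structure IsKirchbergAlgebra : Prop where
  separable : TopologicalSpace.SeparableSpace A
  nuclear : IsNuclearCStar A
  simple : IsSimpleCStar A
  purelyInfinite : IsPurelyInfiniteCStar A

end Kirchberg

/-! ### The group `K₀` of a unital C*-algebra -/

section KZero

variable {A : Type*} [CStarAlgebra A]

/-- Projections in the star algebra of `m × m` matrices over `A`. -/
def IsMatrixProj {m : Type*} [Fintype m] (p : Matrix m m A) : Prop :=
  p * p = p ∧ pᴴ = p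

/-- Murray-von Neumann equivalence of (projection) matrices of possibly different sizes. -/
def MvNEquiv {m n : Type*} [Fintype m] [Fintype n] (p : Matrix m m A) (q : Matrix n n A) : Prop :=
  ∃ v : Matrix n m A, vᴴ * v = p ∧ v * vᴴ = q

section blocks

variable {k m n : Type*}

/-- The block diagonal sum `p ⊕ q`. -/
def blockSum (p : Matrix m m A) (q : Matrix n n A) : Matrix (m ⊕ n) (m ⊕ n) A :=
  Matrix.fromBlocks p 0 0 q

theorem blockSum_swap (p : Matrix m m A) (q : Matrix n n A) :
    (blockSum p q).submatrix (Equiv.sumComm n m) (Equiv.sumComm n m) = blockSum q p := by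
  ext i j
  rcases i with i | i <;> rcases j with j | j <;> rfl

theorem blockSum_assoc (p : Matrix k k A) (q : Matrix m m A) (r : Matrix n n A) :
    (blockSum p (blockSum q r)).submatrix (Equiv.sumAssoc k m n) (Equiv.sumAssoc k m n) =
      blockSum (blockSum p q) r := by
  ext i j
  rcases i with (i | i) | i <;> rcases j with (j | j) | j <;> rfl

theorem blockSum_empty [IsEmpty n] (p : Matrix m m A) (q : Matrix n n A) :
    (blockSum p q).submatrix (Equiv.sumEmpty m n).symm (Equiv.sumEmpty m n).symm = p := by
  ext i j
  rfl

end blocks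

section lemmas

variable {k l m n : Type*} [Fintype k] [Fintype l] [Fintype m] [Fintype n]

theorem MvNEquiv.refl {p : Matrix m m A} (hp : IsMatrixProj p) : MvNEquiv p p :=
  ⟨p, by rw [hp.2, hp.1], by rw [hp.2, hp.1]⟩

theorem MvNEquiv.symm {p : Matrix m m A} {q : Matrix n n A} (h : MvNEquiv p q) :
    MvNEquiv q p := by
  obtain ⟨v, h1, h2⟩ := h
  exact ⟨vᴴ, by simpa using h2, by simpa using h1⟩

theorem MvNEquiv.trans {p : Matrix l l A} {q : Matrix m m A} {r : Matrix n n A}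
    (hp : IsMatrixProj p) (hr : IsMatrixProj r)
    (h : MvNEquiv p q) (h' : MvNEquiv q r) : MvNEquiv p r := by
  obtain ⟨v, rfl, h2⟩ := h
  obtain ⟨w, h3, rfl⟩ := h'
  refine ⟨w * v, ?_, ?_⟩
  · rw [Matrix.conjTranspose_mul]
    calc vᴴ * wᴴ * (w * v) = vᴴ * (wᴴ * w) * v := by simp only [Matrix.mul_assoc]
      _ = (vᴴ * v) * (vᴴ * v) := by rw [h3, ← h2]; simp only [Matrix.mul_assoc]
      _ = vᴴ * v := hp.1
  · rw [Matrix.conjTranspose_mul]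
    calc w * v * (vᴴ * wᴴ) = w * (v * vᴴ) * wᴴ := by simp only [Matrix.mul_assoc]
      _ = (w * wᴴ) * (w * wᴴ) := by rw [h2, ← h3]; simp only [Matrix.mul_assoc]
      _ = w * wᴴ := hr.1

theorem IsMatrixProj.zero : IsMatrixProj (0 : Matrix m m A) :=
  ⟨by simp, by simp⟩

theorem IsMatrixProj.blockSum {p : Matrix m m A} {q : Matrix n n A} (hp : IsMatrixProj p)
    (hq : IsMatrixProj q) : IsMatrixProj (blockSum p q) := by
  constructor
  · simp [_root_.blockSum, Matrix.fromBlocks_multiply, hp.1, hq.1]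
  · simp [_root_.blockSum, Matrix.fromBlocks_conjTranspose, hp.2, hq.2]

theorem IsMatrixProj.submatrix {p : Matrix m m A} (hp : IsMatrixProj p) (e : n ≃ m) :
    IsMatrixProj (p.submatrix e e) := by
  constructor
  · rw [Matrix.submatrix_mul_equiv, hp.1]
  · rw [Matrix.conjTranspose_submatrix, hp.2]

theorem MvNEquiv.submatrix {p : Matrix m m A} (hp : IsMatrixProj p) (e : n ≃ m) :
    MvNEquiv p (p.submatrix e e) := by
  refine ⟨p.submatrix e id, ?_, ?_⟩
  · rw [Matrix.conjTranspose_submatrix, Matrix.submatrix_mul_equiv, hp.2, hp.1,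
      Matrix.submatrix_id_id]
  · rw [Matrix.conjTranspose_submatrix, hp.2,
      ← Matrix.submatrix_mul p p e id e Function.bijective_id, hp.1]

theorem MvNEquiv.blockSum {p : Matrix k k A} {p' : Matrix l l A} {q : Matrix m m A}
    {q' : Matrix n n A} (h : MvNEquiv p p') (h' : MvNEquiv q q') :
    MvNEquiv (blockSum p q) (blockSum p' q') := by
  obtain ⟨v, rfl, rfl⟩ := h
  obtain ⟨w, rfl, rfl⟩ := h'
  refine ⟨Matrix.fromBlocks v 0 0 w, ?_, ?_⟩ <;>
  simp [_root_.blockSum, Matrix.fromBlocks_multiply, Matrix.fromBlocks_conjTranspose]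

end lemmas

variable (A)

/-- Projections in matrix algebras `M_n(A)`, with `n` arbitrary. -/
structure MatProj where
  size : ℕ
  mat : Matrix (Fin size) (Fin size) A
  isProj : IsMatrixProj mat

variable {A}

/-- A projection matrix indexed by any finite type, with its indices enumerated. -/
def MatProj.ofFintype {m : Type*} [Fintype m] (p : Matrix m m A) (hp : IsMatrixProj p) :
    MatProj A :=
  ⟨Fintype.card m, p.submatrix (Fintype.equivFin m).symm (Fintype.equivFin m).symm,
    hp.submatrix _⟩

theorem MatProj.ofFintype_equiv {m : Type*} [Fintype m] (p : Matrix m m A) (hp : IsMatrixProj p) :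
    MvNEquiv p (MatProj.ofFintype p hp).mat :=
  MvNEquiv.submatrix hp _

variable (A) in
/-- Murray-von Neumann equivalence on projections over matrix algebras. -/
instance MatProj.setoid : Setoid (MatProj A) where
  r p q := MvNEquiv p.mat q.mat
  iseqv :=
    { refl := fun p => MvNEquiv.refl p.isProj
      symm := fun h => h.symm
      trans := fun {p _ r} h h' => h.trans p.isProj r.isProj h' }

variable (A) in
/-- The Murray-von Neumann semigroup `V(A)`. -/
def VMonoid : Type _ := Quotient (MatProj.setoid A)

/-- The class in `V(A)` of a projection matrix over `A`. -/
def VMonoid.mk {m : Type*} [Fintype m] (p : Matrix m m A) (hp : IsMatrixProj p) : VMonoid A :=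
  Quotient.mk (MatProj.setoid A) (MatProj.ofFintype p hp)

theorem VMonoid.mk_eq_mk {m n : Type*} [Fintype m] [Fintype n] {p : Matrix m m A}
    {q : Matrix n n A} (hp : IsMatrixProj p) (hq : IsMatrixProj q) :
    VMonoid.mk p hp = VMonoid.mk q hq ↔ MvNEquiv p q := by
  have h1 := MatProj.ofFintype_equiv p hp
  have h2 := MatProj.ofFintype_equiv q hq
  refine Quotient.eq.trans ⟨fun h => ?_, fun h => ?_⟩
  · exact (h1.trans hp (MatProj.isProj _) h).trans hp hq h2.symm
  · exact (h1.symm.trans (MatProj.isProj _) hq h).trans (MatProj.isProj _) (MatProj.isProj _) h2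

theorem VMonoid.ind {P : VMonoid A → Prop}
    (h : ∀ (n : ℕ) (p : Matrix (Fin n) (Fin n) A) (hp : IsMatrixProj p), P (VMonoid.mk p hp))
    (x : VMonoid A) : P x := by
  induction x using Quotient.inductionOn with
  | h p =>
    have : VMonoid.mk p.mat p.isProj = Quotient.mk (MatProj.setoid A) p :=
      Quotient.sound (MatProj.ofFintype_equiv p.mat p.isProj).symm
    rw [← this]
    exact h _ _ _

instance VMonoid.instZero : Zero (VMonoid A) :=
  ⟨VMonoid.mk (0 : Matrix (Fin 0) (Fin 0) A) IsMatrixProj.zero⟩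

/-- Addition on `V(A)` is induced by the block diagonal sum. -/
instance VMonoid.instAdd : Add (VMonoid A) :=
  ⟨Quotient.lift₂ (fun p q => VMonoid.mk (blockSum p.mat q.mat) (p.isProj.blockSum q.isProj))
    (fun _ _ _ _ h h' => (VMonoid.mk_eq_mk _ _).2 (MvNEquiv.blockSum h h'))⟩

theorem VMonoid.mk_add_mk {m n : Type*} [Fintype m] [Fintype n] {p : Matrix m m A}
    {q : Matrix n n A} (hp : IsMatrixProj p) (hq : IsMatrixProj q) :
    VMonoid.mk p hp + VMonoid.mk q hq = VMonoid.mk (blockSum p q) (hp.blockSum hq) :=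
  (VMonoid.mk_eq_mk _ _).2
    (MvNEquiv.blockSum (MatProj.ofFintype_equiv p hp).symm (MatProj.ofFintype_equiv q hq).symm)

theorem VMonoid.add_comm' (x y : VMonoid A) : x + y = y + x := by
  induction x using VMonoid.ind with | h m p hp =>
  induction y using VMonoid.ind with | h n q hq =>
  rw [VMonoid.mk_add_mk, VMonoid.mk_add_mk, VMonoid.mk_eq_mk, ← blockSum_swap p q]
  exact MvNEquiv.submatrix (hp.blockSum hq) _

theorem VMonoid.add_zero' (x : VMonoid A) : x + 0 = x := by
  induction x using VMonoid.ind with | h m p hp =>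
  change VMonoid.mk p hp + VMonoid.mk (0 : Matrix (Fin 0) (Fin 0) A) IsMatrixProj.zero = _
  rw [VMonoid.mk_add_mk, VMonoid.mk_eq_mk]
  have h := MvNEquiv.submatrix (hp.blockSum (IsMatrixProj.zero (A := A) (m := Fin 0)))
    (Equiv.sumEmpty (Fin m) (Fin 0)).symm
  rwa [blockSum_empty] at h

instance VMonoid.instAddCommMonoid : AddCommMonoid (VMonoid A) where
  add_assoc x y z := by
    induction x using VMonoid.ind with | h l p hp =>
    induction y using VMonoid.ind with | h m q hq =>
    induction z using VMonoid.ind with | h n r hr =>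
    simp only [VMonoid.mk_add_mk]
    rw [VMonoid.mk_eq_mk, ← blockSum_assoc p q r]
    exact (MvNEquiv.submatrix (hp.blockSum (hq.blockSum hr)) _).symm
  zero_add x := by rw [VMonoid.add_comm', VMonoid.add_zero']
  add_zero := VMonoid.add_zero'
  add_comm := VMonoid.add_comm'
  nsmul := nsmulRec

variable (A) in
/-- `K₀(A)` of a unital C*-algebra: the Grothendieck group of `V(A)`. -/
abbrev KZero : Type _ := Algebra.GrothendieckAddGroup (VMonoid A)

/-- The class `[p]₀ ∈ K₀(A)` of a projection `p ∈ A`, regarded as a `1 × 1` matrix. -/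
def kZeroClass (p : A) (hp : IsStarProjection p) : KZero A :=
  Algebra.GrothendieckAddGroup.of
    (VMonoid.mk (Matrix.of fun _ _ : Fin 1 => p)
      ⟨by ext i j; simpa [Matrix.mul_apply] using hp.isIdempotentElem.eq,
        by ext i j; simpa using hp.isSelfAdjoint.star_eq⟩)

end KZero

end

-- Write `q = 1 - p`. Left multiplication by `u = 1 - 2p` is `-1` on `p` and `+1` on `q`, so if `x`
-- is a partial isometry from `q` into `p`, then `u` exchanges `q + x` and `q - x`, whose ranges are
-- orthogonal. Halved conjugates `(q + x) c (q + x)* / 2` are thus orthogonal to their images under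
-- `u`, and adding the image cancels the cross terms, leaving `x c x* + q c q`.
--
-- Pure infiniteness gives `v` with `v*v = q` and `vv* = p - r`. One tower with `c = q` would
-- produce `1 - r`; the defect `r` is the problem. It is spread thin: put `m` orthogonal copies of
-- `r` inside `q`, via `w i`, and push them into `p` by `v`. A second tower pairs the `i`-th copy of
-- `r` in `p` with the `i`-th copy in `q`, with a weight `d i` that is removed from `c` in the first
-- tower. The weights fall in steps of `1/(m+1)`, so the total telescopes to `1 - Z/(m+1)` with `Z`
-- a projection (`exists_towers`).
--
-- The isometries come from Cuntz's comparison argument: simplicity writes `1` as a finite sum of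
-- conjugates of a positive element, and an infinite projection has room for the corresponding
-- orthogonal pieces (`IsInfiniteProjection.exists_isometry`).

-- Cuntz comparison: isometries inside nonzero projections.

section CuntzComparison

variable {A : Type*} [CStarAlgebra A] [PartialOrder A] [StarOrderedRing A]

omit [PartialOrder A] [StarOrderedRing A] in
/-- In a simple unital C*-algebra, a nonzero element generates the whole algebra as a two-sided
ideal, without taking the closure. -/
theorem IsSimpleCStar.one_mem_span {g : A} (hA : IsSimpleCStar A) (hg : g ≠ 0) :
    (1 : A) ∈ TwoSidedIdeal.span {g} := by
  let J := TwoSidedIdeal.span ({g} : Set A)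
  have hgJ : g ∈ J := TwoSidedIdeal.subset_span rfl
  let I : TwoSidedIdeal A := .mk' (closure (J : Set A)) (subset_closure J.zero_mem)
    (fun hx hy => map_mem_closure₂ continuous_add hx hy fun _ ha _ hb => J.add_mem ha hb)
    (fun hx => map_mem_closure continuous_neg hx fun _ ha => J.neg_mem ha)
    (fun {x _} hy => map_mem_closure (continuous_const_mul x) hy fun _ ha => J.mul_mem_left x _ ha)
    (fun {_ y} hx => map_mem_closure (f := (· * y)) (continuous_mul_const y) hx
      fun a ha => J.mul_mem_right a y ha)
  have hI : (I : Set A) = closure (J : Set A) := by ext; simp [I]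
  have hI' : I = ⊤ := by
    refine (hA.2 I (hI ▸ isClosed_closure)).resolve_left fun h => hg ?_
    have : g ∈ (I : Set A) := hI ▸ subset_closure hgJ
    rw [h] at this
    simpa using this
  have h1 : (1 : A) ∈ closure (J : Set A) := by
    rw [← hI, hI']
    trivial
  -- Units form a neighbourhood of `1`, so the dense ideal `J` contains one of them.
  have hU : {x : A | IsUnit x} ∈ nhds (1 : A) := Units.isOpen.mem_nhds isUnit_one
  obtain ⟨_, ⟨y, rfl⟩, hyJ⟩ := mem_closure_iff_nhds.1 h1 _ hU
  have := J.mul_mem_left (↑y⁻¹ : A) _ hyJ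
  rwa [Units.inv_mul] at this

/-- Two-sided multiples of a positive element have real part dominated by a sum of
conjugates of that element. -/
theorem exists_mem_closure_conjugate_ge {g z : A} (hg : 0 ≤ g)
    (hz : z ∈ TwoSidedIdeal.span {g}) :
    ∃ h ∈ AddSubmonoid.closure (Set.range fun x : A => star x * g * x),
      z + star z ≤ h ∧ -(z + star z) ≤ h := by
  rw [TwoSidedIdeal.mem_span_iff_mem_addSubgroup_closure] at hz
  induction hz using AddSubgroup.closure_induction with
  | mem z hz =>
    obtain ⟨_, ⟨a, -, g', hg', rfl⟩, b, -, rfl⟩ := hz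
    obtain rfl : g' = g := hg'
    have hgs : star g' = g' := (IsSelfAdjoint.of_nonneg hg).star_eq
    refine ⟨_, add_mem (AddSubmonoid.subset_closure ⟨star a, rfl⟩)
      (AddSubmonoid.subset_closure ⟨b, rfl⟩), ?_, ?_⟩
    · rw [← sub_nonneg]
      -- The cross terms of `(a* - b)* g (a* - b) ≥ 0` are exactly `-(agb + (agb)*)`; the sign is
      -- flipped for the other bound.
      convert star_left_conjugate_nonneg hg (star a - b) using 1
      simp only [star_mul, star_sub, star_star, hgs]
      noncomm_ring
    · rw [← sub_nonneg]
      convert star_left_conjugate_nonneg hg (star a + b) using 1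
      simp only [star_mul, star_add, star_star, hgs]
      noncomm_ring
  | zero => exact ⟨0, zero_mem _, by simp, by simp⟩
  | add z z' _ _ h h' =>
    obtain ⟨k, hk, h1, h2⟩ := h
    obtain ⟨k', hk', h1', h2'⟩ := h'
    refine ⟨k + k', add_mem hk hk', ?_, ?_⟩
    · convert add_le_add h1 h1' using 1
      rw [star_add]; abel
    · convert add_le_add h2 h2' using 1
      rw [star_add]; abel
  | neg z _ h =>
    obtain ⟨k, hk, h1, h2⟩ := h
    refine ⟨k, hk, ?_, ?_⟩
    · convert h2 using 1
      rw [star_neg]; abel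
    · convert h1 using 1
      rw [star_neg]; abel

omit [PartialOrder A] [StarOrderedRing A] in
theorem conjugate_mem_closure_conjugate {g h : A}
    (hh : h ∈ AddSubmonoid.closure (Set.range fun x : A => star x * g * x)) (k : A) :
    star k * h * k ∈ AddSubmonoid.closure (Set.range fun x : A => star x * g * x) := by
  induction hh using AddSubmonoid.closure_induction with
  | mem _ h =>
    obtain ⟨x, rfl⟩ := h
    exact AddSubmonoid.subset_closure ⟨x * k, by simp [mul_assoc]⟩
  | zero => simp
  | add a b _ _ h h' =>
    rw [mul_add, add_mul]
    exact add_mem h h'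

/-- In a simple unital C*-algebra, the unit is a finite sum of conjugates of any nonzero positive
element. -/
theorem IsSimpleCStar.one_mem_closure_conjugate {g : A} (hA : IsSimpleCStar A) (hg : 0 ≤ g)
    (hg0 : g ≠ 0) :
    (1 : A) ∈ AddSubmonoid.closure (Set.range fun x : A => star x * g * x) := by
  obtain ⟨h, hh, h1, -⟩ := exists_mem_closure_conjugate_ge hg (hA.one_mem_span hg0)
  have h1' : (1 : A) ≤ h := by
    refine le_trans ?_ h1
    simp
  have hpos : IsStrictlyPositive h :=
    IsStrictlyPositive.of_le isStrictlyPositive_one h1'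
  have hk : star (h ^ (-(1 / 2) : ℝ)) = h ^ (-(1 / 2) : ℝ) :=
    (IsSelfAdjoint.of_nonneg CFC.rpow_nonneg).star_eq
  -- Since `h ≥ 1` is invertible, conjugating it by `h ^ (-1/2)` gives `1`.
  convert conjugate_mem_closure_conjugate hh (h ^ (-(1 / 2) : ℝ)) using 1
  have h2 : h = h ^ (1 / 2 : ℝ) * h ^ (1 / 2 : ℝ) := by
    rw [← CFC.rpow_add hpos.isUnit]
    norm_num [CFC.rpow_one h]
  calc (1 : A) = (h ^ (-(1 / 2) : ℝ) * h ^ (1 / 2 : ℝ)) * (h ^ (1 / 2 : ℝ) * h ^ (-(1 / 2) : ℝ)) := by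
        rw [CFC.rpow_neg_mul_rpow _ hpos, CFC.rpow_mul_rpow_neg _ hpos, one_mul]
    _ = h ^ (-(1 / 2) : ℝ) * (h ^ (1 / 2 : ℝ) * h ^ (1 / 2 : ℝ)) * h ^ (-(1 / 2) : ℝ) := by
        noncomm_ring
    _ = _ := by rw [← h2, hk]

omit [PartialOrder A] [StarOrderedRing A] in
theorem IsStarProjection.mul_eq_of_star_mul_self_eq {e s : A} (he : IsStarProjection e)
    (hs : star s * s = e) : s * e = s := by
  rw [← sub_eq_zero, ← CStarRing.star_mul_self_eq_zero_iff]
  calc star (s * e - s) * (s * e - s)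
      = star e * (star s * s) * e - star e * (star s * s) - (star s * s) * e + star s * s := by
        rw [star_sub, star_mul]; noncomm_ring
    _ = 0 := by simp [hs, he.isSelfAdjoint.star_eq, he.isIdempotentElem.eq]

/-- In a simple unital C*-algebra, the unit is subequivalent to every infinite projection. -/
theorem IsInfiniteProjection.exists_isometry {e : A} (hA : IsSimpleCStar A)
    (he : IsInfiniteProjection e) : ∃ w : A, star w * w = 1 ∧ e * w = w := by
  obtain ⟨hep, s, hs, hle, hne⟩ := he
  have hee := hep.isIdempotentElem.eq
  have hes := hep.isSelfAdjoint.star_eq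
  have hse : s * e = s := hep.mul_eq_of_star_mul_self_eq hs
  have hes' : e * star s = star s := by
    have := congrArg star hse
    rwa [star_mul, hes] at this
  have hsp : IsStarProjection (s * star s) :=
    ⟨by
      change s * star s * (s * star s) = _
      rw [← mul_assoc, mul_assoc s, hs, hse], .mul_star_self s⟩
  have hess : e * (s * star s) = s * star s := (hsp.le_iff_mul_eq_right hep).1 hle
  have hes2 : e * s = s := by
    have := congrArg (· * s) hess
    simpa [mul_assoc, hs, hse] using this
  have hg : IsStarProjection (e - s * star s) := (hsp.le_iff_sub hep).1 hle
  have hg0 : e - s * star s ≠ 0 := fun h => hne (sub_eq_zero.1 h).symm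
  have hsg : star s * (e - s * star s) = 0 := by
    rw [mul_sub, ← mul_assoc, hs, hes']
    have := congrArg star hes2
    rw [star_mul, hes] at this
    rw [this, sub_self]
  have heg : e * (e - s * star s) = e - s * star s := by rw [mul_sub, hee, hess]
  -- The induction also carries `t`, a copy of `e` inside `e` orthogonal to the range of `w`: this
  -- is the room into which the next summand is moved. It starts with `t = s`, the piece `e - ss*`
  -- being free.
  suffices ∀ h ∈ AddSubmonoid.closure (Set.range fun x : A => star x * (e - s * star s) * x),
      ∃ w t : A, star w * w = h ∧ e * w = w ∧ star t * t = e ∧ e * t = t ∧ star t * w = 0 by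
    obtain ⟨w, -, h1, h2, -⟩ := this 1 (hA.one_mem_closure_conjugate hg.nonneg hg0)
    exact ⟨w, h1, h2⟩
  intro h hh
  induction hh using AddSubmonoid.closure_induction with
  | mem _ h =>
    obtain ⟨x, rfl⟩ := h
    refine ⟨(e - s * star s) * x, s, ?_, by rw [← mul_assoc, heg], hs, hes2,
      by rw [← mul_assoc, hsg, zero_mul]⟩
    rw [star_mul, hg.isSelfAdjoint.star_eq, ← mul_assoc, mul_assoc (star x),
      hg.isIdempotentElem.eq]
  | zero => exact ⟨0, s, by simp, by simp, hs, hes2, by simp⟩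
  | add a b _ _ h h' =>
    obtain ⟨w, t, rfl, h2, h3, h4, h5⟩ := h
    obtain ⟨w', t', rfl, h2', h3', h4', h5'⟩ := h'
    have h6 : star w * t = 0 := by simpa using congrArg star h5
    refine ⟨w + t * w', t * t', ?_, by rw [mul_add, ← mul_assoc, h2, h4], ?_,
      by rw [← mul_assoc, h4], ?_⟩
    · calc star (w + t * w') * (w + t * w')
          = star w * w + (star w * t) * w' + star w' * (star t * w)
            + star w' * ((star t * t) * w') := by
            rw [star_add, star_mul]; noncomm_ring
        _ = _ := by simp [h3, h5, h6, h2']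
    · calc star (t * t') * (t * t') = star t' * ((star t * t) * t') := by
            rw [star_mul]; noncomm_ring
        _ = _ := by rw [h3, h4', h3']
    · calc star (t * t') * (w + t * w')
          = star t' * (star t * w) + star t' * ((star t * t) * w') := by
            rw [star_mul]; noncomm_ring
        _ = _ := by rw [h3, h5, h2', h5', mul_zero, add_zero]

/-- The corner `q A q` cut out by a projection `q`. -/
def cornerSubalgebra (q : A) (hq : IsStarProjection q) : NonUnitalStarSubalgebra ℂ A where
  carrier := {a | q * a = a ∧ a * q = a}
  add_mem' := fun ⟨h1, h2⟩ ⟨h3, h4⟩ => ⟨by rw [mul_add, h1, h3], by rw [add_mul, h2, h4]⟩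
  zero_mem' := by simp
  mul_mem' := fun ⟨h1, _⟩ ⟨_, h4⟩ => ⟨by rw [← mul_assoc, h1], by rw [mul_assoc, h4]⟩
  smul_mem' := fun c _ ⟨h1, h2⟩ => ⟨by rw [mul_smul_comm, h1], by rw [smul_mul_assoc, h2]⟩
  star_mem' := fun {a} ⟨h1, h2⟩ =>
    ⟨by simpa [hq.isSelfAdjoint.star_eq] using congrArg star h2,
      by simpa [hq.isSelfAdjoint.star_eq] using congrArg star h1⟩

/-- Compressing `0 ≤ a ≤ b` by `1 - q` kills `b`, hence `a`; then `√a (1 - q) = 0` by the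
C*-identity, so `a = aq`. -/
theorem isHereditary_cornerSubalgebra (q : A) (hq : IsStarProjection q) :
    IsHereditaryCStarSubalgebra (cornerSubalgebra q hq) where
  isClosed := (isClosed_eq (continuous_const_mul q) continuous_id).inter
    (isClosed_eq (continuous_mul_const q) continuous_id)
  mem_of_le a b ha hab hb := by
    have hr := hq.one_sub
    have hrs := hr.isSelfAdjoint.star_eq
    have h0 : star (1 - q) * a * (1 - q) = 0 := by
      refine le_antisymm ?_ (star_left_conjugate_nonneg ha _)
      refine (star_left_conjugate_le_conjugate hab _).trans_eq ?_
      rw [mul_assoc, mul_sub, mul_one, hb.2, sub_self, mul_zero]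
    have h1 : CFC.sqrt a * (1 - q) = 0 := by
      rw [← CStarRing.star_mul_self_eq_zero_iff, star_mul,
        (IsSelfAdjoint.of_nonneg (CFC.sqrt_nonneg a)).star_eq]
      rw [← h0]
      conv_rhs => rw [← CFC.sqrt_mul_sqrt_self a ha]
      noncomm_ring
    have h2 : a * q = a := by
      have : a * (1 - q) = 0 := by
        rw [← CFC.sqrt_mul_sqrt_self a ha, mul_assoc, h1, mul_zero]
      rw [mul_sub, mul_one, sub_eq_zero] at this
      exact this.symm
    refine ⟨?_, h2⟩
    simpa [hq.isSelfAdjoint.star_eq, (IsSelfAdjoint.of_nonneg ha).star_eq] using congrArg star h2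

theorem IsPurelyInfiniteCStar.exists_infinite_le {q : A} (hA : IsPurelyInfiniteCStar A)
    (hq : IsStarProjection q) (hq0 : q ≠ 0) : ∃ e, IsInfiniteProjection e ∧ q * e = e := by
  obtain ⟨e, he, hinf⟩ := hA _ (isHereditary_cornerSubalgebra q hq) fun h => hq0 <| by
    have : q ∈ cornerSubalgebra q hq := ⟨hq.isIdempotentElem.eq, hq.isIdempotentElem.eq⟩
    rwa [h, NonUnitalStarAlgebra.mem_bot] at this
  exact ⟨e, hinf, he.1⟩

theorem exists_isometry_of_projection (hs : IsSimpleCStar A) (hi : IsPurelyInfiniteCStar A)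
    {q : A} (hq : IsStarProjection q) (hq0 : q ≠ 0) : ∃ w : A, star w * w = 1 ∧ q * w = w := by
  obtain ⟨e, he, hqe⟩ := hi.exists_infinite_le hq hq0
  obtain ⟨w, h1, h2⟩ := he.exists_isometry hs
  exact ⟨w, h1, by rw [← h2, ← mul_assoc, hqe]⟩

/-- In a purely infinite simple unital C*-algebra, every nonzero projection contains the ranges of
a sequence of isometries with mutually orthogonal ranges. -/
theorem exists_orthogonal_isometries (hs : IsSimpleCStar A) (hi : IsPurelyInfiniteCStar A)
    {q : A} (hq : IsStarProjection q) (hq0 : q ≠ 0) :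
    ∃ w : ℕ → A, (∀ i j, star (w i) * w j = if i = j then 1 else 0) ∧ ∀ i, q * w i = w i := by
  obtain ⟨e, ⟨he, s, hse, hle, hne⟩, hqe⟩ := hi.exists_infinite_le hq hq0
  have hsp : IsStarProjection (s * star s) := by
    refine ⟨?_, .mul_star_self s⟩
    change s * star s * (s * star s) = _
    rw [← mul_assoc, mul_assoc s, hse, he.mul_eq_of_star_mul_self_eq hse]
  have hess : e * (s * star s) = s * star s := (hsp.le_iff_mul_eq_right he).1 hle
  have hs0 : s * star s ≠ 0 := fun h => by
    have h' : s = 0 := by rwa [CStarRing.mul_star_self_eq_zero_iff] at h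
    exact hne (by rw [h, ← hse, h', mul_zero])
  obtain ⟨a, ha, hsa⟩ := exists_isometry_of_projection hs hi hsp hs0
  obtain ⟨b, hb, hgb⟩ := exists_isometry_of_projection hs hi ((hsp.le_iff_sub he).1 hle)
    (fun h => hne (sub_eq_zero.1 h).symm)
  have hab : star a * b = 0 := by
    rw [← hsa, ← hgb, star_mul, hsp.isSelfAdjoint.star_eq, mul_assoc, ← mul_assoc _ _ b, mul_sub,
      hsp.isIdempotentElem.eq]
    have : s * star s * e = s * star s := (hsp.le_iff_mul_eq_left he).1 hle
    rw [this, sub_self, zero_mul, mul_zero]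
  have hba : star b * a = 0 := by simpa using congrArg star hab
  have hqa : q * a = a := by rw [← hsa, ← hess]; simp only [← mul_assoc, hqe]
  have hqb : q * b = b := by
    rw [← hgb, ← mul_assoc, mul_sub, hqe, ← hess, ← mul_assoc, hqe]
  -- As `a` and `b` are isometries with orthogonal ranges, the `a ^ i * b` are too.
  have key : ∀ i j, star (a ^ i * b) * (a ^ j * b) = if i = j then 1 else 0 := by
    intro i
    induction i with
    | zero =>
      rintro (_ | j)
      · simpa using hb
      · simp [pow_succ', ← mul_assoc, hba]
    | succ i ih =>
      rintro (_ | j)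
      · simp [pow_succ', mul_assoc, hab]
      · rw [pow_succ', pow_succ', mul_assoc, mul_assoc, star_mul, mul_assoc,
          ← mul_assoc (star a), ha, one_mul, ih]
        simp
  refine ⟨fun i => a ^ i * b, key, ?_⟩
  rintro (_ | i)
  · simpa using hqb
  · simp only [pow_succ', ← mul_assoc, hqa]

end CuntzComparison

-- Sums of orthogonal ranges and summation by parts.

section OrthogonalFamily

variable {A : Type*} [CStarAlgebra A]

/-- The sum of the range projections of partial isometries with a common source projection and
mutually orthogonal ranges is a projection. -/
theorem isStarProjection_sum_mul_star {r : A} {z : ℕ → A}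
    (hz : ∀ i j, star (z i) * z j = if i = j then r else 0) (hzr : ∀ i, z i * r = z i) (m : ℕ) :
    IsStarProjection (∑ i ∈ Finset.range m, z i * star (z i)) := by
  have h : ∀ i j, z i * star (z i) * (z j * star (z j)) =
      if i = j then z i * star (z i) else 0 := by
    intro i j
    rw [← mul_assoc, mul_assoc (z i), hz]
    split_ifs with hij
    · rw [hzr, hij]
    · simp
  refine ⟨?_, ?_⟩
  · change _ * _ = _
    rw [Finset.sum_mul_sum]
    refine Finset.sum_congr rfl fun i hi => ?_
    simp only [h, Finset.sum_ite_eq, hi, if_true]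
  · simp [IsSelfAdjoint, star_sum]

/-- Summation by parts against the weights `1, 1 - 1/(m+1), …, 1/(m+1)`, the first one lowered. -/
theorem sum_weights_smul_sub {E : Type*} [AddCommGroup E] [Module ℝ E] (Z : ℕ → E) (m : ℕ) :
    ∑ i ∈ Finset.range m, ((m : ℝ) - i) • (Z i - Z (i + 1)) =
      ((m : ℝ) + 1) • Z 0 - ∑ i ∈ Finset.range (m + 1), Z i := by
  induction m with
  | zero => simp
  | succ m ih =>
    -- Raising `m` by one raises every weight by one, which adds a telescoping sum; the old weight
    -- at `i = m` is zero.
    have h : ∑ i ∈ Finset.range (m + 1), (((m + 1 : ℕ) : ℝ) - i) • (Z i - Z (i + 1)) =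
        ∑ i ∈ Finset.range (m + 1), ((m : ℝ) - i) • (Z i - Z (i + 1)) +
          ∑ i ∈ Finset.range (m + 1), (Z i - Z (i + 1)) := by
      rw [← Finset.sum_add_distrib]
      refine Finset.sum_congr rfl fun i _ => ?_
      push_cast
      module
    rw [h, Finset.sum_range_succ, sub_self, zero_smul, add_zero, ih, Finset.sum_range_sub',
      Finset.sum_range_succ _ (m + 1)]
    push_cast
    module

end OrthogonalFamily

-- Construction of the two towers.

section Tower

variable {A : Type*} [CStarAlgebra A] [PartialOrder A] [StarOrderedRing A]

/-- A projection `p`, a partial isometry `v` embedding `1 - p` into `p` with defect `r`, and `m`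
orthogonal copies of `r` inside `1 - p` give two towers for conjugation by `1 - 2 * p`, up to
an error of at most `1 / (m + 1)`. -/
theorem exists_towers {p v r : A} (hp : IsStarProjection p)
    (hvv : star v * v = 1 - p) (hpv : p * v = v) (hr : v * star v = p - r)
    {w : ℕ → A} (hw : ∀ i j, star (w i) * w j = if i = j then r else 0)
    (hpw : ∀ i, p * w i = 0) (hwr : ∀ i, w i * r = w i) (m : ℕ) :
    ∃ f : Fin 2 → A,
      (∀ i, 0 ≤ f i ∧ ‖f i‖ ≤ 1) ∧
      (∀ i, f i * ((1 - 2 * p) * f i * star (1 - 2 * p)) = 0) ∧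
      ‖(∑ i, (f i + (1 - 2 * p) * f i * star (1 - 2 * p))) - 1‖ ≤ 1 / ((m : ℝ) + 1) := by
  have hps := hp.isSelfAdjoint.star_eq
  have hpp := hp.isIdempotentElem.eq
  have hvq : v * (1 - p) = v := hp.one_sub.mul_eq_of_star_mul_self_eq hvv
  have hvp : v * p = 0 := by rwa [mul_sub, mul_one, sub_eq_self] at hvq
  have hpv' : star v * p = star v := by simpa [hps] using congrArg star hpv
  have hvsp : IsStarProjection (v * star v) := by
    refine ⟨?_, .mul_star_self v⟩
    change v * star v * (v * star v) = _
    rw [← mul_assoc, mul_assoc v, hvv, hvq]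
  have hrv : r = p - v * star v := by rw [hr]; abel
  have hrp : IsStarProjection r := by
    rw [hrv]
    refine IsStarProjection.sub_of_mul_eq_left hvsp hp ?_
    rw [mul_assoc, hpv']
  have hrs := hrp.isSelfAdjoint.star_eq
  have hrr := hrp.isIdempotentElem.eq
  have hpr : p * r = r := by rw [hrv, mul_sub, hpp, ← mul_assoc, hpv]
  have hrv0 : r * v = 0 := by rw [hrv, sub_mul, hpv, mul_assoc, hvv, hvq, sub_self]
  have hvr0 : star v * r = 0 := by simpa [hrs] using congrArg star hrv0
  have hwp : ∀ i, star (w i) * p = 0 := fun i => by simpa [hps] using congrArg star (hpw i)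
  -- Copies of `r` inside `p`: the defect itself, then the images under `v` of the copies in `q`.
  -- The index shift is what makes the sum telescope.
  let z : ℕ → A := fun i => Nat.casesOn i r fun j => v * w j
  have hz0 : z 0 = r := rfl
  have hzs : ∀ i, z (i + 1) = v * w i := fun _ => rfl
  have hpz : ∀ i, p * z i = z i := by
    rintro (_ | i)
    · exact hpr
    · rw [hzs, ← mul_assoc, hpv]
  have hzr : ∀ i, z i * r = z i := by
    rintro (_ | i)
    · exact hrr
    · rw [hzs, mul_assoc, hwr]
  have hz : ∀ i j, star (z i) * z j = if i = j then r else 0 := by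
    rintro (_ | i) (_ | j)
    · simp [hz0, hrs, hrr]
    · simp [hz0, hzs, hrs, ← mul_assoc, hrv0]
    · simp [hz0, hzs, mul_assoc, hvr0]
    · rw [hzs, hzs, star_mul, mul_assoc, ← mul_assoc (star v), hvv, sub_mul, hpw, sub_zero,
        one_mul, hw]
      simp
  have hwz : ∀ i j, star (w i) * z j = 0 := fun i j => by
    rw [← hpz, ← mul_assoc, hwp, zero_mul]
  have hzw : ∀ i j, star (z i) * w j = 0 := fun i j => by
    simpa using congrArg star (hwz j i)
  have hm : (0 : ℝ) < m + 1 := by positivity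
  -- Weights falling from `m/(m+1)` in equal steps, reaching `0` at `i = m`, so `m` copies in `q`
  -- suffice.
  let d : ℕ → ℝ := fun i => ((m : ℝ) - i) / (m + 1)
  have hd0 : ∀ i ∈ Finset.range m, 0 ≤ d i := fun i hi => by
    have : (i : ℝ) ≤ m := by exact_mod_cast (Finset.mem_range.1 hi).le
    exact div_nonneg (sub_nonneg.2 this) hm.le
  have hd1 : ∀ i, d i ≤ 1 := fun i => by
    rw [div_le_one hm]
    have : (0 : ℝ) ≤ i := by positivity
    linarith
  let D : A := ∑ i ∈ Finset.range m, d i • (w i * star (w i))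
  let W : A := ∑ i ∈ Finset.range m, w i * star (w i)
  have hWp : IsStarProjection W := isStarProjection_sum_mul_star hw hwr m
  have hpW : p * W = 0 := by simp [W, Finset.mul_sum, ← mul_assoc, hpw]
  have hDW : D ≤ W := Finset.sum_le_sum fun i _ =>
    (smul_le_smul_of_nonneg_right (hd1 i) (mul_star_self_nonneg _)).trans_eq (one_smul _ _)
  have hWq : W ≤ 1 - p := by
    rw [hWp.le_iff_mul_eq_right hp.one_sub, sub_mul, hpW, one_mul, sub_zero]
  -- What remains of `q` once the second tower has taken its share `D`.
  let c : A := 1 - p - D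
  have hc : 0 ≤ c := sub_nonneg.2 (hDW.trans hWq)
  have hcs : star c = c := (IsSelfAdjoint.of_nonneg hc).star_eq
  have hpD : p * D = 0 := by simp [D, Finset.mul_sum, ← mul_assoc, hpw]
  have hpc : p * c = 0 := by simp [c, mul_sub, hpD, hpp]
  have hcp : c * p = 0 := by simpa [hps, hcs] using congrArg star hpc
  let u : A := 1 - 2 * p
  have hu : star u = u := by simp [u, star_sub, hps, two_mul]
  have hup : ∀ x, p * x = x → u * x = -x := fun x hx => by
    simp only [u, sub_mul, one_mul, mul_assoc, hx]; noncomm_ring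
  have huq : ∀ x, p * x = 0 → u * x = x := fun x hx => by
    simp only [u, sub_mul, one_mul, mul_assoc, hx]; noncomm_ring
  let f₀ : A := (1 / 2 : ℝ) • ((v + (1 - p)) * c * star (v + (1 - p)))
  let f₁ : A := (1 / 2 : ℝ) •
    ∑ i ∈ Finset.range m, d i • ((z i + w i) * star (z i + w i))
  have huf₀ : u * f₀ * star u = (1 / 2 : ℝ) • ((1 - p - v) * c * star (1 - p - v)) := by
    have h : u * (v + (1 - p)) = 1 - p - v := by
      rw [mul_add, hup v hpv, huq (1 - p) (by rw [mul_sub, hpp, mul_one, sub_self])]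
      abel
    rw [← h, star_mul]
    simp only [f₀, mul_smul_comm, smul_mul_assoc]
    noncomm_ring
  have huf₁ : u * f₁ * star u = (1 / 2 : ℝ) •
      ∑ i ∈ Finset.range m, d i • ((w i - z i) * star (w i - z i)) := by
    have h : ∀ i, u * (z i + w i) = w i - z i := fun i => by
      rw [mul_add, hup _ (hpz i), huq _ (hpw i)]
      abel
    simp only [f₁, mul_smul_comm, smul_mul_assoc, Finset.mul_sum, Finset.sum_mul, ← h, star_mul,
      mul_assoc]
  have hf₀ : 0 ≤ f₀ := smul_nonneg (by norm_num) (star_right_conjugate_nonneg hc _)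
  have hf₁ : 0 ≤ f₁ := smul_nonneg (by norm_num)
    (Finset.sum_nonneg fun i hi => smul_nonneg (hd0 i hi) (mul_star_self_nonneg _))
  have horth₀ : f₀ * (u * f₀ * star u) = 0 := by
    have h : star (v + (1 - p)) * (1 - p - v) = 0 := by
      simp only [star_add, star_sub, star_one, hps, add_mul, mul_sub, sub_mul, mul_one, one_mul,
        hpv', hpv, hpp, hvv]
      abel
    rw [huf₀]
    simp only [f₀, mul_smul_comm, smul_mul_assoc]
    have : (v + (1 - p)) * c * star (v + (1 - p)) * ((1 - p - v) * c * star (1 - p - v)) =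
        (v + (1 - p)) * c * (star (v + (1 - p)) * (1 - p - v)) * (c * star (1 - p - v)) := by
      simp only [mul_assoc]
    rw [this, h]
    simp
  have horth₁ : f₁ * (u * f₁ * star u) = 0 := by
    have h : ∀ i j, star (z i + w i) * (w j - z j) = 0 := fun i j => by
      rw [star_add, add_mul, mul_sub, mul_sub, hz, hw, hwz, hzw]
      abel
    rw [huf₁]
    simp only [f₁, mul_smul_comm, smul_mul_assoc, Finset.sum_mul_sum]
    have h' : ∀ i j, (z i + w i) * star (z i + w i) * ((w j - z j) * star (w j - z j)) = 0 :=
      fun i j => by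
        rw [mul_assoc, ← mul_assoc (star _), h, zero_mul, mul_zero]
    simp only [h', smul_zero, Finset.sum_const_zero]
  let Z : A := ∑ i ∈ Finset.range (m + 1), z i * star (z i)
  have hZp : IsStarProjection Z := isStarProjection_sum_mul_star hz hzr (m + 1)
  have hsum₀ : f₀ + u * f₀ * star u = v * c * star v + c := by
    have hqc : (1 - p) * c * (1 - p) = c := by
      rw [sub_mul, hpc, mul_sub, mul_one, one_mul, sub_zero, hcp, sub_zero]
    rw [huf₀]
    calc f₀ + (1 / 2 : ℝ) • ((1 - p - v) * c * star (1 - p - v))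
        = (1 / 2 : ℝ) • ((2 : ℝ) • (v * c * star v + (1 - p) * c * (1 - p))) := by
          simp only [f₀, ← smul_add, star_add, star_sub, star_one, hps]
          congr 1
          rw [two_smul]
          noncomm_ring
      _ = _ := by rw [hqc, smul_smul]; norm_num
  have hsum₁ : f₁ + u * f₁ * star u =
      ∑ i ∈ Finset.range m, d i • (z i * star (z i)) + D := by
    rw [huf₁]
    simp only [f₁, D, ← smul_add, ← Finset.sum_add_distrib]
    rw [Finset.smul_sum]
    refine Finset.sum_congr rfl fun i _ => ?_
    rw [smul_comm]
    congr 1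
    have : (z i + w i) * star (z i + w i) + (w i - z i) * star (w i - z i) =
        (2 : ℝ) • (z i * star (z i) + w i * star (w i)) := by
      rw [two_smul, star_add, star_sub]
      noncomm_ring
    rw [this, smul_smul]
    norm_num
  have hvcv : v * c * star v = p - r -
      ∑ i ∈ Finset.range m, d i • (z (i + 1) * star (z (i + 1))) := by
    simp only [c, D, mul_sub, sub_mul, hvp, mul_one, sub_zero, hr, Finset.mul_sum,
      Finset.sum_mul, mul_smul_comm, smul_mul_assoc, hzs, star_mul, mul_assoc]
  -- The two occurrences of `D` cancel, leaving `1 - r + ∑ d i (Z i - Z (i+1))` with `Z i = z i (z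
  -- i)*`; summation by parts evaluates this.
  have hsum : (f₀ + u * f₀ * star u) + (f₁ + u * f₁ * star u) = 1 - ((m : ℝ) + 1)⁻¹ • Z := by
    have habel := sum_weights_smul_sub (fun i => z i * star (z i)) m
    have hdiff : ∑ i ∈ Finset.range m, d i • (z i * star (z i)) -
        ∑ i ∈ Finset.range m, d i • (z (i + 1) * star (z (i + 1))) = r - ((m : ℝ) + 1)⁻¹ • Z := by
      rw [← Finset.sum_sub_distrib]
      calc ∑ i ∈ Finset.range m, (d i • (z i * star (z i)) - d i • (z (i + 1) * star (z (i + 1))))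
          = ((m : ℝ) + 1)⁻¹ • ∑ i ∈ Finset.range m, ((m : ℝ) - i) •
              (z i * star (z i) - z (i + 1) * star (z (i + 1))) := by
            rw [Finset.smul_sum]
            refine Finset.sum_congr rfl fun i _ => ?_
            rw [← smul_sub, smul_smul]
            congr 1
            exact div_eq_inv_mul _ _
        _ = _ := by
            rw [habel, smul_sub, smul_smul, inv_mul_cancel₀ hm.ne', one_smul, hz0, hrs, hrr]
    rw [hsum₀, hsum₁, hvcv, ← sub_eq_zero]
    rw [← sub_eq_zero] at hdiff
    rw [← hdiff]
    simp only [c]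
    abel
  -- Contractivity of each tower follows: both are summands of a sum of positive elements bounded by
  -- `1`.
  have hle : (f₀ + u * f₀ * star u) + (f₁ + u * f₁ * star u) ≤ 1 := by
    rw [hsum]
    exact sub_le_self _ (smul_nonneg (by positivity) hZp.nonneg)
  have huf₀' : 0 ≤ u * f₀ * star u := star_right_conjugate_nonneg hf₀ _
  have huf₁' : 0 ≤ u * f₁ * star u := star_right_conjugate_nonneg hf₁ _
  refine ⟨![f₀, f₁], ?_, ?_, ?_⟩
  · refine Fin.forall_fin_two.2 ⟨⟨hf₀, ?_⟩, ⟨hf₁, ?_⟩⟩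
    · rw [Matrix.cons_val_zero, CStarAlgebra.norm_le_one_iff_of_nonneg _ hf₀]
      refine le_trans ?_ hle
      rw [add_assoc]
      exact le_add_of_nonneg_right (add_nonneg huf₀' (add_nonneg hf₁ huf₁'))
    · rw [Matrix.cons_val_one, Matrix.cons_val_zero, CStarAlgebra.norm_le_one_iff_of_nonneg _ hf₁]
      refine le_trans ?_ hle
      rw [add_left_comm]
      exact le_add_of_nonneg_right (add_nonneg (add_nonneg hf₀ huf₀') huf₁')
  · exact Fin.forall_fin_two.2 ⟨horth₀, horth₁⟩
  · rw [Fin.sum_univ_two]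
    change ‖(f₀ + u * f₀ * star u) + (f₁ + u * f₁ * star u) - 1‖ ≤ _
    rw [hsum, sub_sub_cancel_left, norm_neg, norm_smul, Real.norm_of_nonneg (by positivity),
      one_div]
    exact mul_le_of_le_one_right (by positivity) (IsStarProjection.norm_le _ hZp)

end Tower

-- Assembly.

theorem lemma2p1 {A : Type*} [CStarAlgebra A] [PartialOrder A] [StarOrderedRing A]
    (hA : IsKirchbergAlgebra A) (p : A) (hp : IsStarProjection p)
    (hp0 : p ≠ 0) (hp1 : p ≠ 1) (hK : kZeroClass p hp = 0)
    (u : A) (hu : u = 1 - 2 * p) (ε : ℝ) (hε : 0 < ε) :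
    ∃ f : Fin 2 → A,
      (∀ i, 0 ≤ f i ∧ ‖f i‖ ≤ 1) ∧
      (∀ i, f i * (u * f i * star u) = 0) ∧
      ‖(∑ i, (f i + u * f i * star u)) - 1‖ ≤ ε := by
  subst hu
  obtain ⟨m, hm⟩ := exists_nat_one_div_lt hε
  have hq := hp.one_sub
  have hqs := hq.isSelfAdjoint.star_eq
  obtain ⟨a, ha, hpa⟩ := exists_isometry_of_projection hA.simple hA.purelyInfinite hp hp0
  obtain ⟨b, hb, hqb⟩ := exists_orthogonal_isometries hA.simple hA.purelyInfinite hq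
    (sub_ne_zero.2 hp1.symm)
  have hpb : ∀ i, p * b i = 0 := fun i => by
    rw [← hqb, ← mul_assoc, mul_sub, mul_one, hp.isIdempotentElem.eq, sub_self, zero_mul]
  have hvv : star (a * (1 - p)) * (a * (1 - p)) = 1 - p := by
    rw [star_mul, hqs, mul_assoc, ← mul_assoc (star a), ha, one_mul, hq.isIdempotentElem.eq]
  have hpv : p * (a * (1 - p)) = a * (1 - p) := by rw [← mul_assoc, hpa]
  have hvsp : IsStarProjection (a * (1 - p) * star (a * (1 - p))) := by
    refine ⟨?_, .mul_star_self _⟩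
    change _ * _ = _
    rw [← mul_assoc, mul_assoc (a * (1 - p)), hvv, hq.mul_eq_of_star_mul_self_eq hvv]
  have hr : IsStarProjection (p - a * (1 - p) * star (a * (1 - p))) := by
    rw [← hvsp.le_iff_sub hp, hvsp.le_iff_mul_eq_right hp, ← mul_assoc, hpv]
  set r := p - a * (1 - p) * star (a * (1 - p))
  -- Cutting the isometries `b i` into `q` down to `r` gives the copies of `r`; `m` was chosen with
  -- `1/(m+1) < ε`.
  obtain ⟨f, h1, h2, h3⟩ := exists_towers (w := fun i => b i * r) (r := r) hp hvv hpv
    (sub_sub_cancel _ _).symm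
    (fun i j => by
      rw [star_mul, mul_assoc, ← mul_assoc (star (b i)), hb, hr.isSelfAdjoint.star_eq]
      split_ifs
      · rw [one_mul, hr.isIdempotentElem.eq]
      · simp)
    (fun i => by rw [← mul_assoc, hpb, zero_mul])
    (fun i => by rw [mul_assoc, hr.isIdempotentElem.eq]) m
  exact ⟨f, h1, h2, h3.trans hm.le⟩
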